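/- Let $\mathcal H,\mathcal K$ be complex Hilbert spaces, let $0<m\le M$ be real numbers, and let $A$ be a bounded operator on $\mathcal H$ with $mI\le A\le MI$. Let $X,Y$ be isometries on $\mathcal H$ whose final spaces (ranges) are orthogonal to each other. Let $\Phi:\mathcal B(\mathcal H)\to\mathcal B(\mathcal K)$ be a unital ($\Phi(I)=I$) $2$-positive linear map, i.e. for all $S,T,U\in\mathcal B(\mathcal H)$, $$\begin{bmatrix} S&T\\ T^*&U\end{bmatrix}\ge 0\quad\text{implies}\quad \begin{bmatrix} \Phi(S)&\Phi(T)\\ \Phi(T^*)&\Phi(U)\end{bmatrix}\ge 0 .$$ Then $\Phi(Y^*AY)$ and $\Phi(X^*AX)$ are positive and invertible, the operator $Z:=\Phi(X^*AY)\,\Phi(Y^*AY)^{-1}\,\Phi(Y^*AX)$ is positive, and, in the operator norm, $$\left\|Z^{p/2}\,\Phi(X^*AX)^{-p/2}\right\|\le \frac{(M-m)^p\,(M+m)^{p/2}}{2^{2+p/2}\,M^{3p/4}m^{3p/4}}\qquad\text{for all real } p\ge 2,$$ $$\left\|Z^{p/2}\,\Phi(X^*AX)^{-p/2}\right\|\le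 \frac{(M-m)^p\,(M^2+m^2)^{p/2}}{2^{2+p/2}\,M^{3p/4}m^{3p/4}\,(M+m)^{p/2}}\qquad\text{for all real } p\ge 4.$$ -/

import Mathlib

open scoped InnerProductSpace

namespace WielandtNorm

noncomputable section

/-- The operator matrix `[A B; C D]` acting on the Hilbert space direct sum `H ⊕ H`,
`(x, y) ↦ (A x + B y, C x + D y)`. -/
def opMatrix {H : Type*} [NormedAddCommGroup H] [InnerProductSpace ℂ H]
    (A B C D : H →L[ℂ] H) : WithLp 2 (H × H) →L[ℂ] WithLp 2 (H × H) :=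
  (WithLp.prodContinuousLinearEquiv 2 ℂ H H).symm.toContinuousLinearMap ∘L
    ((A.coprod B).prod (C.coprod D)) ∘L
      (WithLp.prodContinuousLinearEquiv 2 ℂ H H).toContinuousLinearMap

/-- A linear map `Φ : B(H) → B(K)` is 2-positive if `[A B; B* C] ≥ 0` implies
`[Φ(A) Φ(B); Φ(B*) Φ(C)] ≥ 0`. -/
def IsTwoPositive {H K : Type*}
    [NormedAddCommGroup H] [InnerProductSpace ℂ H] [CompleteSpace H]
    [NormedAddCommGroup K] [InnerProductSpace ℂ K]
    (Φ : (H →L[ℂ] H) →ₗ[ℂ] (K →L[ℂ] K)) : Prop :=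
  ∀ A B C : H →L[ℂ] H, 0 ≤ opMatrix A B (star B) C →
    0 ≤ opMatrix (Φ A) (Φ B) (Φ (star B)) (Φ C)

/-- The operator `Φ(X*AY) Φ(Y*AY)⁻¹ Φ(Y*AX)`. (`Ring.inverse` is the inverse of an invertible
operator.) -/
def wielandtOp {H K : Type*}
    [NormedAddCommGroup H] [InnerProductSpace ℂ H] [CompleteSpace H]
    [NormedAddCommGroup K] [InnerProductSpace ℂ K]
    (Φ : (H →L[ℂ] H) →ₗ[ℂ] (K →L[ℂ] K)) (A X Y : H →L[ℂ] H) : K →L[ℂ] K :=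
  Φ (star X * A * Y) * Ring.inverse (Φ (star Y * A * Y)) * Φ (star Y * A * X)

end

end WielandtNorm

namespace WielandtNorm

/-! ### A norm bound for products of positive operators. -/

section Norm

variable {E : Type*} [NormedAddCommGroup E] [InnerProductSpace ℂ E]

/-! Write `T` for `Φ(X*AX)`, `Z` for the Wielandt operator, `k = (M-m)/(M+m)`. Wielandt's inequality
on orthogonal vectors makes a 2×2 operator matrix in `A, X, Y` positive; 2-positivity carries it
through `Φ`, and its Schur complement gives `Z ≤ k² T`, while `m ≤ T ≤ M`.

The norm bounds come from `‖PQ‖ ≤ ‖P + Q‖² / 4` for positive `P, Q`, in the normalised form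
`norm_mul_le_of_add_le_one`. Combining `Z ≤ k² T` with `T⁻¹ + (Mm)⁻¹ T ≤ (M+m)/(Mm)` bounds `αZ +
α⁻¹T⁻¹` by a scalar for a suitable weight `α`. Raising to a power `r ≥ 1` costs nothing: after
normalisation both summands are contractions, and powers `r ≥ 1` only decrease those. With `r = p/2`
this gives a bound sharper than the one claimed for `p ≥ 2`.

For `p ≥ 4` the same argument runs on `Z²` and `T⁻²` with `r = p/4`. Squaring is not operator
monotone, so `Z² ≤ κ T²` is obtained at the price of a Kantorovich-type factor
(`sq_le_smul_sq_of_le_smul`). -/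

theorem re_inner_le_of_le {A B : E →L[ℂ] E} (h : A ≤ B) (x : E) :
    RCLike.re ⟪A x, x⟫_ℂ ≤ RCLike.re ⟪B x, x⟫_ℂ := by
  have := ((ContinuousLinearMap.le_def _ _).1 h).re_inner_nonneg_left x
  simpa [inner_sub_left] using this

theorem re_inner_nonneg {A : E →L[ℂ] E} (h : 0 ≤ A) (x : E) :
    0 ≤ RCLike.re ⟪A x, x⟫_ℂ := by
  simpa using re_inner_le_of_le h x

theorem inner_symm_of_nonneg {A : E →L[ℂ] E} (h : 0 ≤ A) (x y : E) :
    ⟪A x, y⟫_ℂ = ⟪x, A y⟫_ℂ :=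
  ((ContinuousLinearMap.nonneg_iff_isPositive _).1 h).inner_left_eq_inner_right x y

theorem re_inner_comm_of_nonneg {A : E →L[ℂ] E} (h : 0 ≤ A) (x y : E) :
    RCLike.re ⟪A x, y⟫_ℂ = RCLike.re ⟪A y, x⟫_ℂ := by
  rw [inner_symm_of_nonneg h, inner_re_symm]

theorem re_inner_add_self {A : E →L[ℂ] E} (h : 0 ≤ A) (x y : E) :
    RCLike.re ⟪A (x + y), x + y⟫_ℂ =
      RCLike.re ⟪A x, x⟫_ℂ + 2 * RCLike.re ⟪A x, y⟫_ℂ + RCLike.re ⟪A y, y⟫_ℂ := by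
  have := re_inner_comm_of_nonneg h x y
  simp only [map_add, inner_add_left, inner_add_right]
  linarith

theorem re_inner_sub_self {A : E →L[ℂ] E} (h : 0 ≤ A) (x y : E) :
    RCLike.re ⟪A (x - y), x - y⟫_ℂ =
      RCLike.re ⟪A x, x⟫_ℂ - 2 * RCLike.re ⟪A x, y⟫_ℂ + RCLike.re ⟪A y, y⟫_ℂ := by
  have := re_inner_comm_of_nonneg h x y
  simp only [map_sub, inner_sub_left, inner_sub_right]
  linarith

theorem re_inner_self_eq (x : E) : RCLike.re ⟪x, x⟫_ℂ = ‖x‖ ^ 2 :=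
  inner_self_eq_norm_sq x

theorem norm_apply_sq_le_of_le_one {B : E →L[ℂ] E} (hB : 0 ≤ B) (hB1 : B ≤ 1) (v : E) :
    ‖B v‖ ^ 2 ≤ RCLike.re ⟪B v, v⟫_ℂ := by
  have h1 := re_inner_nonneg hB (v - B v)
  have h2 := re_inner_le_of_le hB1 (B v)
  rw [re_inner_sub_self hB] at h1
  rw [one_apply_eq_self] at h2
  have := re_inner_self_eq (B v)
  linarith

variable [CompleteSpace E]

/-- With `C = A + B` and `g = Bv + Au`, polarisation bounds the left side by `⟪Cg, g⟫`. Positivity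
of `A` at `u - g` and of `B` at `v - g` bounds the right side below by `2‖g‖² - ⟪Cg, g⟫`, and `C ≤
1` closes the gap. -/
theorem four_re_inner_le_of_add_le_one {A B : E →L[ℂ] E} (hA : 0 ≤ A) (hB : 0 ≤ B)
    (hAB : A + B ≤ 1) (u v : E) :
    4 * RCLike.re ⟪(A + B) (B v), A u⟫_ℂ ≤ RCLike.re ⟪A u, u⟫_ℂ + RCLike.re ⟪B v, v⟫_ℂ := by
  have hC : 0 ≤ A + B := add_nonneg hA hB
  set g := B v + A u with hg
  have h1 := re_inner_add_self hC (B v) (A u)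
  have h2 := re_inner_sub_self hC (B v) (A u)
  have h3 := re_inner_nonneg hC (B v - A u)
  have h4 := re_inner_le_of_le hAB g
  have h5 := re_inner_nonneg hA (u - g)
  have h6 := re_inner_nonneg hB (v - g)
  rw [re_inner_sub_self hA] at h5
  rw [re_inner_sub_self hB] at h6
  have h7 : RCLike.re ⟪B v, g⟫_ℂ + RCLike.re ⟪A u, g⟫_ℂ = RCLike.re ⟪g, g⟫_ℂ := by
    rw [← map_add, ← inner_add_left]
  have h8 : RCLike.re ⟪(A + B) g, g⟫_ℂ = RCLike.re ⟪A g, g⟫_ℂ + RCLike.re ⟪B g, g⟫_ℂ := by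
    simp
  rw [one_apply_eq_self] at h4
  linarith

/-- The Bhatia–Kittaneh inequality for the operator norm, normalised. -/
theorem norm_mul_le_of_add_le_one {A B : E →L[ℂ] E} (hA : 0 ≤ A) (hB : 0 ≤ B)
    (hAB : A + B ≤ 1) : ‖A * B‖ ≤ 1 / 4 := by
  by_contra! hs
  set s := ‖A * B‖ with hs_def
  have hA1 : A ≤ 1 := le_trans (le_add_of_nonneg_right hB) hAB
  have hB1 : B ≤ 1 := le_trans (le_add_of_nonneg_left hA) hAB
  have hnA : ‖A‖ ≤ 1 := (CStarAlgebra.norm_le_one_iff_of_nonneg A hA).2 hA1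
  have hnB : ‖B‖ ≤ 1 := (CStarAlgebra.norm_le_one_iff_of_nonneg B hB).2 hB1
  have hBA : ‖B * A‖ = s := by
    rw [hs_def, ← norm_star (A * B), star_mul, (IsSelfAdjoint.of_nonneg hA).star_eq,
      (IsSelfAdjoint.of_nonneg hB).star_eq]
  have key : ∀ v : E, ‖v‖ ≤ 1 →
      (4 * s - 1) ^ 2 * (‖(A * B) v‖ ^ 2) ^ 2 ≤ 16 * (s ^ 2 - ‖(A * B) v‖ ^ 2) := by
    intro v hv
    set w := (A * B) v with hw
    have hw' : w = A (B v) := rfl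
    -- The defect of `v` from being a top singular vector of `AB`. If `e` were `0`, the preceding
    -- lemma at `w` and `s • v` would give `4s ≤ 1` at once; here `e` is an error term, small when
    -- `‖w‖` is near `s`.
    set e : E := ((s ^ 2 : ℝ) : ℂ) • v - B (A w) with he
    have h1 := four_re_inner_le_of_add_le_one hA hB hAB w (((s : ℝ) : ℂ) • v)
    have h2 : RCLike.re ⟪B (B v), A w⟫_ℂ =
        s ^ 2 * RCLike.re ⟪B v, v⟫_ℂ - RCLike.re ⟪B v, e⟫_ℂ := by
      have : B (A w) = ((s ^ 2 : ℝ) : ℂ) • v - e := by rw [he]; abel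
      rw [inner_symm_of_nonneg hB, this, inner_sub_right, inner_smul_right, map_sub]
      congr 1
      exact Complex.re_ofReal_mul _ _
    have h3 : RCLike.re ⟪(A + B) (B (((s : ℝ) : ℂ) • v)), A w⟫_ℂ =
        s * (RCLike.re ⟪A w, w⟫_ℂ + RCLike.re ⟪B (B v), A w⟫_ℂ) := by
      rw [map_smul, map_smul, inner_smul_left, add_apply, inner_add_left,
        ← hw', ← inner_symm_of_nonneg hA w w, Complex.conj_ofReal]
      exact Complex.re_ofReal_mul _ _
    have h4 : RCLike.re ⟪B (((s : ℝ) : ℂ) • v), ((s : ℝ) : ℂ) • v⟫_ℂ =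
        s ^ 2 * RCLike.re ⟪B v, v⟫_ℂ := by
      rw [map_smul, inner_smul_left, inner_smul_right, Complex.conj_ofReal, ← mul_assoc,
        ← Complex.ofReal_mul, pow_two]
      exact Complex.re_ofReal_mul _ _
    rw [h3, h4, h2] at h1
    have hs0 : 0 < s := by linarith
    have h5 : RCLike.re ⟪B v, e⟫_ℂ ≤ ‖e‖ := by
      calc RCLike.re ⟪B v, e⟫_ℂ ≤ ‖B v‖ * ‖e‖ := re_inner_le_norm _ _
        _ ≤ 1 * ‖e‖ := by
          gcongr
          calc ‖B v‖ ≤ ‖B‖ * ‖v‖ := B.le_opNorm v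
            _ ≤ 1 * 1 := by gcongr
            _ = 1 := one_mul 1
        _ = ‖e‖ := one_mul _
    have h6 : ‖w‖ ^ 2 ≤ RCLike.re ⟪B v, v⟫_ℂ := by
      refine le_trans ?_ (norm_apply_sq_le_of_le_one hB hB1 v)
      gcongr
      calc ‖w‖ ≤ ‖A‖ * ‖B v‖ := A.le_opNorm _
        _ ≤ 1 * ‖B v‖ := by gcongr
        _ = _ := one_mul _
    have h7 := re_inner_nonneg hA w
    have h8 : ‖e‖ ^ 2 ≤ s ^ 2 * (s ^ 2 - ‖w‖ ^ 2) := by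
      have i1 : ‖B (A w)‖ ≤ s * ‖w‖ := by
        rw [← hBA]; exact (B * A).le_opNorm w
      have i2 : RCLike.re ⟪((s ^ 2 : ℝ) : ℂ) • v, B (A w)⟫_ℂ = s ^ 2 * ‖w‖ ^ 2 := by
        rw [inner_smul_left, ← inner_symm_of_nonneg hB, ← inner_symm_of_nonneg hA, ← hw',
          Complex.conj_ofReal, ← re_inner_self_eq w]
        exact Complex.re_ofReal_mul _ _
      have i3 := norm_sub_sq (𝕜 := ℂ) (((s ^ 2 : ℝ) : ℂ) • v) (B (A w))
      rw [← he, i2, norm_smul, Complex.norm_real, Real.norm_of_nonneg (by positivity)] at i3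
      have i4 : ‖B (A w)‖ ^ 2 ≤ (s * ‖w‖) ^ 2 := by gcongr
      have i5 : (s ^ 2 * ‖v‖) ^ 2 ≤ (s ^ 2 * 1) ^ 2 := by gcongr
      linarith
    have h9 : (4 * s - 1) * (s * ‖w‖ ^ 2) ≤ 4 * ‖e‖ := by
      have j1 : (4 * s - 1) * (s ^ 2 * ‖w‖ ^ 2) ≤
          (4 * s - 1) * (RCLike.re ⟪A w, w⟫_ℂ + s ^ 2 * RCLike.re ⟪B v, v⟫_ℂ) := by
        gcongr
        · linarith
        · nlinarith [sq_nonneg s]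
      have j2 : s * ((4 * s - 1) * (s * ‖w‖ ^ 2)) ≤ s * (4 * ‖e‖) := by
        nlinarith [mul_le_mul_of_nonneg_left h5 hs0.le]
      exact le_of_mul_le_mul_left j2 hs0
    have h10 : ((4 * s - 1) * (s * ‖w‖ ^ 2)) ^ 2 ≤ (4 * ‖e‖) ^ 2 := by
      have : 0 ≤ 4 * s - 1 := by linarith
      gcongr
    have h11 : s ^ 2 * ((4 * s - 1) ^ 2 * (‖w‖ ^ 2) ^ 2) ≤ s ^ 2 * (16 * (s ^ 2 - ‖w‖ ^ 2)) := by
      nlinarith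
    exact le_of_mul_le_mul_left h11 (by positivity)
  have hlim : ∀ r : ℝ, 0 < r → r < s → (4 * s - 1) ^ 2 * (r ^ 2) ^ 2 ≤ 16 * (s ^ 2 - r ^ 2) := by
    intro r hr hrs
    obtain ⟨v, hv, hrv⟩ := (A * B).exists_lt_apply_of_lt_opNorm hrs
    have h := key v hv.le
    have h1 : r ^ 2 ≤ ‖(A * B) v‖ ^ 2 := by gcongr
    calc (4 * s - 1) ^ 2 * (r ^ 2) ^ 2 ≤ (4 * s - 1) ^ 2 * (‖(A * B) v‖ ^ 2) ^ 2 := by gcongr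
      _ ≤ 16 * (s ^ 2 - ‖(A * B) v‖ ^ 2) := h
      _ ≤ 16 * (s ^ 2 - r ^ 2) := by gcongr
  have hs0 : 0 < s := by linarith
  -- The norm of `AB` need not be attained, so `r` tends to `s` from below.
  have hle : (4 * s - 1) ^ 2 * (s ^ 2) ^ 2 ≤ 16 * (s ^ 2 - s ^ 2) := by
    have c1 : Filter.Tendsto (fun r : ℝ => (4 * s - 1) ^ 2 * (r ^ 2) ^ 2)
        (nhdsWithin s (Set.Iio s)) (nhds ((4 * s - 1) ^ 2 * (s ^ 2) ^ 2)) :=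
      ((by fun_prop : Continuous fun r : ℝ => (4 * s - 1) ^ 2 * (r ^ 2) ^ 2).tendsto s).mono_left
        nhdsWithin_le_nhds
    have c2 : Filter.Tendsto (fun r : ℝ => 16 * (s ^ 2 - r ^ 2))
        (nhdsWithin s (Set.Iio s)) (nhds (16 * (s ^ 2 - s ^ 2))) :=
      ((by fun_prop : Continuous fun r : ℝ => 16 * (s ^ 2 - r ^ 2)).tendsto s).mono_left
        nhdsWithin_le_nhds
    refine le_of_tendsto_of_tendsto c1 c2 ?_
    filter_upwards [Ioo_mem_nhdsLT hs0] with r hr using hlim r hr.1 hr.2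
  have : 0 < (4 * s - 1) ^ 2 * (s ^ 2) ^ 2 := by
    have : 0 < 4 * s - 1 := by linarith
    positivity
  linarith

end Norm

/-! ### Real powers and quadratic inequalities for operators between `m` and `M`. -/

section Powers

variable {E : Type*} [NormedAddCommGroup E] [InnerProductSpace ℂ E] [CompleteSpace E]

theorem re_inner_real_smul {F : Type*} [NormedAddCommGroup F] [InnerProductSpace ℂ F] (c : ℝ)
    (x y : F) : RCLike.re ⟪c • x, y⟫_ℂ = c * RCLike.re ⟪x, y⟫_ℂ := by
  rw [← Complex.coe_smul, inner_smul_left, Complex.conj_ofReal]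
  exact Complex.re_ofReal_mul _ _

theorem spectrum_le_of_le_smul_one {T : E →L[ℂ] E} {b : ℝ} (hT : 0 ≤ T)
    (h : T ≤ b • (1 : E →L[ℂ] E)) : ∀ x ∈ spectrum ℝ T, x ≤ b := by
  rw [← Algebra.algebraMap_eq_smul_one] at h
  exact (le_algebraMap_iff_spectrum_le (IsSelfAdjoint.of_nonneg hT)).1 h

theorem le_spectrum_of_smul_one_le {T : E →L[ℂ] E} {a : ℝ} (hT : 0 ≤ T)
    (h : a • (1 : E →L[ℂ] E) ≤ T) : ∀ x ∈ spectrum ℝ T, a ≤ x := by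
  rw [← Algebra.algebraMap_eq_smul_one] at h
  exact (algebraMap_le_iff_le_spectrum (IsSelfAdjoint.of_nonneg hT)).1 h

theorem nonneg_of_smul_one_le {T : E →L[ℂ] E} {m : ℝ} (hm : 0 ≤ m)
    (h : m • (1 : E →L[ℂ] E) ≤ T) : 0 ≤ T :=
  le_trans (smul_nonneg hm zero_le_one) h

theorem isStrictlyPositive_of_smul_one_le {T : E →L[ℂ] E} {m : ℝ} (hm : 0 < m)
    (h : m • (1 : E →L[ℂ] E) ≤ T) : IsStrictlyPositive T := by
  have h0 := nonneg_of_smul_one_le hm.le h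
  refine ⟨h0, spectrum.isUnit_of_zero_notMem ℝ fun h1 => ?_⟩
  exact absurd (le_spectrum_of_smul_one_le h0 h 0 h1) (not_le.2 hm)

theorem rpow_le_smul_self {B : E →L[ℂ] E} {L r : ℝ} (hB : 0 ≤ B)
    (hBL : B ≤ L • (1 : E →L[ℂ] E)) (hr : 1 ≤ r) : B ^ r ≤ L ^ (r - 1) • B := by
  have hsp := spectrum_le_of_le_smul_one hB hBL
  have hr0 : 0 ≤ r - 1 := by linarith
  rw [CFC.rpow_eq_cfc_real hB]
  have h2 : L ^ (r - 1) • B = cfc (fun x : ℝ => L ^ (r - 1) * x) B :=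
    (cfc_const_mul_id (L ^ (r - 1)) B).symm
  rw [h2, cfc_le_iff _ _ _ (Real.continuous_rpow_const (by linarith)).continuousOn]
  intro x hx
  have hx0 : 0 ≤ x := spectrum_nonneg_of_nonneg hB hx
  rcases hx0.eq_or_lt with h | h
  · rw [← h, Real.zero_rpow (by linarith), mul_zero]
  · calc x ^ r = x ^ (r - 1) * x := by
          rw [← Real.rpow_add_one h.ne']; ring_nf
      _ ≤ L ^ (r - 1) * x := by
          gcongr
          exact hsp x hx

/-- The hypothesis makes `αP/N` and `α⁻¹Q/N` positive with sum at most `1`. Each dominates its own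
`r`-th power, so the powers also sum to at most `1`; the weights cancel in the product. -/
theorem norm_rpow_mul_rpow_le {P Q : E →L[ℂ] E} {α N r : ℝ} (hP : 0 ≤ P) (hQ : 0 ≤ Q)
    (hα : 0 < α) (hN : 0 < N) (hr : 1 ≤ r)
    (h : α • P + α⁻¹ • Q ≤ N • (1 : E →L[ℂ] E)) : ‖P ^ r * Q ^ r‖ ≤ (N ^ r) ^ 2 / 4 := by
  have scale : ∀ (β : ℝ) (R : E →L[ℂ] E), 0 < β → 0 ≤ R → β • R ≤ N • (1 : E →L[ℂ] E) →
      ((β / N) ^ r) • R ^ r ≤ (β / N) • R := by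
    intro β R hβ hR hle
    have h1 : R ≤ (N / β) • (1 : E →L[ℂ] E) := by
      have := smul_le_smul_of_nonneg_left hle (inv_nonneg.2 hβ.le)
      rwa [smul_smul, smul_smul, inv_mul_cancel₀ hβ.ne', one_smul, inv_mul_eq_div] at this
    have h2 := smul_le_smul_of_nonneg_left (rpow_le_smul_self hR h1 hr)
      (Real.rpow_nonneg (div_pos hβ hN).le r)
    rw [smul_smul] at h2
    convert h2 using 2
    rw [← inv_div, Real.inv_rpow (by positivity), ← Real.rpow_neg (by positivity),
      ← Real.rpow_add (by positivity)]
    ring_nf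
    rw [Real.rpow_neg_one]
    simp [mul_comm]
  have hP1 := scale α P hα hP (le_trans (le_add_of_nonneg_right (smul_nonneg (by positivity) hQ)) h)
  have hQ1 := scale α⁻¹ Q (by positivity) hQ
    (le_trans (le_add_of_nonneg_left (smul_nonneg hα.le hP)) h)
  have hsum : ((α / N) ^ r) • P ^ r + ((α⁻¹ / N) ^ r) • Q ^ r ≤ 1 := by
    refine (add_le_add hP1 hQ1).trans ?_
    have := smul_le_smul_of_nonneg_left h (inv_nonneg.2 hN.le)
    rw [smul_smul, inv_mul_cancel₀ hN.ne', one_smul, smul_add, smul_smul, smul_smul] at this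
    rwa [div_eq_inv_mul, div_eq_inv_mul]
  have hP2 : 0 ≤ ((α / N) ^ r) • P ^ r := smul_nonneg (by positivity) CFC.rpow_nonneg
  have hQ2 : 0 ≤ ((α⁻¹ / N) ^ r) • Q ^ r := smul_nonneg (by positivity) CFC.rpow_nonneg
  have hbk := norm_mul_le_of_add_le_one hP2 hQ2 hsum
  have hcoef : (α / N) ^ r * (α⁻¹ / N) ^ r = ((N ^ r) ^ 2)⁻¹ := by
    rw [← Real.mul_rpow (by positivity) (by positivity), pow_two, ← Real.mul_rpow hN.le hN.le,
      ← Real.inv_rpow (by positivity)]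
    congr 1
    field_simp
  rw [smul_mul_smul_comm, hcoef, norm_smul, Real.norm_of_nonneg (by positivity),
    inv_mul_le_iff₀ (by positivity)] at hbk
  linarith

/-- On the spectrum this is `(x^s - m^s)(M^s - x^s) ≥ 0` divided by `(Mm)^s x^s`. -/
theorem rpow_neg_add_smul_rpow_le {T : E →L[ℂ] E} {m M s : ℝ} (hm : 0 < m) (hs : 0 < s)
    (hmT : m • (1 : E →L[ℂ] E) ≤ T) (hTM : T ≤ M • (1 : E →L[ℂ] E)) :
    T ^ (-s) + ((M * m) ^ s)⁻¹ • T ^ s ≤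
      ((M ^ s + m ^ s) / (M * m) ^ s) • (1 : E →L[ℂ] E) := by
  have hT := nonneg_of_smul_one_le hm.le hmT
  have h1 := le_spectrum_of_smul_one_le hT hmT
  have h2 := spectrum_le_of_le_smul_one hT hTM
  have c1 : ContinuousOn (fun x : ℝ => x ^ (-s)) (spectrum ℝ T) := fun x hx =>
    (Real.continuousAt_rpow_const x (-s)
      (Or.inl (hm.trans_le (h1 x hx)).ne')).continuousWithinAt
  have c2 : ContinuousOn (fun x : ℝ => x ^ s) (spectrum ℝ T) :=
    (Real.continuous_rpow_const hs.le).continuousOn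
  rw [CFC.rpow_eq_cfc_real hT, CFC.rpow_eq_cfc_real hT, ← cfc_const_mul _ _ _ c2,
    ← cfc_add T (fun x : ℝ => x ^ (-s)) (fun x : ℝ => ((M * m) ^ s)⁻¹ * x ^ s) c1
      (continuousOn_const.mul c2), ← Algebra.algebraMap_eq_smul_one]
  refine cfc_le_algebraMap _ _ _ ?_
  intro x hx
  have hx0 : 0 < x := hm.trans_le (h1 x hx)
  have hM : 0 < M := hx0.trans_le (h2 x hx)
  have i1 : m ^ s ≤ x ^ s := Real.rpow_le_rpow hm.le (h1 x hx) hs.le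
  have i2 : x ^ s ≤ M ^ s := Real.rpow_le_rpow hx0.le (h2 x hx) hs.le
  have p1 : 0 < m ^ s := by positivity
  have p2 : 0 < x ^ s := by positivity
  have p3 : 0 < M ^ s := by positivity
  rw [Real.rpow_neg hx0.le, Real.mul_rpow hM.le hm.le]
  generalize m ^ s = a at *
  generalize x ^ s = b at *
  generalize M ^ s = d at *
  have : (d + a) / (d * a) - (b⁻¹ + (d * a)⁻¹ * b) = (b - a) * (d - b) / (d * a * b) := by
    field_simp
    ring
  have h3 : 0 ≤ (b - a) * (d - b) / (d * a * b) :=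
    div_nonneg (mul_nonneg (by linarith) (by linarith)) (by positivity)
  linarith

theorem le_of_re_inner_le {A B : E →L[ℂ] E} (hA : IsSelfAdjoint A) (hB : IsSelfAdjoint B)
    (h : ∀ x, RCLike.re ⟪A x, x⟫_ℂ ≤ RCLike.re ⟪B x, x⟫_ℂ) : A ≤ B := by
  rw [ContinuousLinearMap.le_def, ContinuousLinearMap.isPositive_def']
  refine ⟨hB.sub hA, fun x => ?_⟩
  have := h x
  simp only [ContinuousLinearMap.reApplyInnerSelf, sub_apply, inner_sub_left, map_sub]
  linarith

/-- This is `(M - T)(T - m) ≥ 0` as a quadratic form. -/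
theorem norm_apply_sq_add_le {T : E →L[ℂ] E} {m M : ℝ} (hm : 0 ≤ m)
    (hmT : m • (1 : E →L[ℂ] E) ≤ T) (hTM : T ≤ M • (1 : E →L[ℂ] E)) (g : E) :
    ‖T g‖ ^ 2 + M * m * ‖g‖ ^ 2 ≤ (M + m) * RCLike.re ⟪T g, g⟫_ℂ := by
  have hT := nonneg_of_smul_one_le hm hmT
  have h1 := le_spectrum_of_smul_one_le hT hmT
  have h2 := spectrum_le_of_le_smul_one hT hTM
  have hsa := IsSelfAdjoint.of_nonneg hT
  have key : T ^ 2 + (M * m) • (1 : E →L[ℂ] E) ≤ (M + m) • T := by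
    rw [← Algebra.algebraMap_eq_smul_one]
    calc T ^ 2 + algebraMap ℝ _ (M * m) = cfc (fun x : ℝ => x ^ 2 + M * m) T := by
          rw [cfc_add_const _ _ _, cfc_pow_id T 2]
      _ ≤ cfc (fun x : ℝ => (M + m) * x) T := by
          rw [cfc_le_iff _ _ _]
          intro x hx
          nlinarith [h1 x hx, h2 x hx]
      _ = (M + m) • T := cfc_const_mul_id (M + m) T
  have := re_inner_le_of_le key g
  have e : ⟪T (T g), g⟫_ℂ = ⟪T g, T g⟫_ℂ := inner_symm_of_nonneg hT _ _
  have e' : ((T ^ 2 : E →L[ℂ] E) + (M * m) • (1 : E →L[ℂ] E)) g = T (T g) + (M * m) • g := by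
    rw [pow_two]; rfl
  rw [e', inner_add_left, e, map_add, re_inner_real_smul, smul_apply, re_inner_real_smul,
    re_inner_self_eq, re_inner_self_eq] at this
  exact this

theorem norm_apply_sq_le_of_mul_eq_one {Z T S : E →L[ℂ] E} {m M c : ℝ} (hm : 0 < m)
    (hmM : m ≤ M) (hmT : m • (1 : E →L[ℂ] E) ≤ T) (hTM : T ≤ M • (1 : E →L[ℂ] E)) (hZ : 0 ≤ Z)
    (hc : 0 < c) (hZT : Z ≤ c • T) (hTS : T * S = 1) (y : E) :
    ‖S (Z y)‖ ^ 2 ≤ (M + m) ^ 2 * c ^ 2 / (4 * (M * m)) * ‖y‖ ^ 2 := by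
  have hM : 0 < M := hm.trans_le hmM
  set g := S (Z y) with hg
  have hTg : T g = Z y :=
    congrArg (fun R : E →L[ℂ] E => R (Z y)) hTS
  have h1 := norm_apply_sq_add_le hm.le hmT hTM g
  rw [hTg] at h1
  -- Expand `Z ≥ 0` at `c • y - g` and use `⟪Zg, g⟫ ≤ c⟪Tg, g⟫ = c⟪Zy, g⟫`.
  have h2 : RCLike.re ⟪Z y, g⟫_ℂ ≤ c * RCLike.re ⟪Z y, y⟫_ℂ := by
    have i1 := re_inner_nonneg hZ (((c : ℝ) : ℂ) • y - g)
    have i2 := re_inner_le_of_le hZT g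
    have i3 : RCLike.re ⟪(c • T) g, g⟫_ℂ = c * RCLike.re ⟪Z y, g⟫_ℂ := by
      rw [smul_apply, hTg, re_inner_real_smul]
    have i4 : RCLike.re ⟪Z (((c : ℝ) : ℂ) • y), ((c : ℝ) : ℂ) • y⟫_ℂ =
        c ^ 2 * RCLike.re ⟪Z y, y⟫_ℂ := by
      rw [map_smul, inner_smul_left, inner_smul_right, Complex.conj_ofReal, ← mul_assoc,
        ← Complex.ofReal_mul, pow_two]
      exact Complex.re_ofReal_mul _ _
    have i5 : RCLike.re ⟪Z (((c : ℝ) : ℂ) • y), g⟫_ℂ = c * RCLike.re ⟪Z y, g⟫_ℂ := by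
      rw [map_smul, inner_smul_left, Complex.conj_ofReal]
      exact Complex.re_ofReal_mul _ _
    rw [re_inner_sub_self hZ, i4, i5] at i1
    rw [i3] at i2
    have : c * RCLike.re ⟪Z y, g⟫_ℂ ≤ c * (c * RCLike.re ⟪Z y, y⟫_ℂ) := by nlinarith
    exact le_of_mul_le_mul_left this hc
  have h3 : RCLike.re ⟪Z y, y⟫_ℂ ≤ ‖Z y‖ * ‖y‖ := re_inner_le_norm _ _
  have h4 : ‖Z y‖ ^ 2 + M * m * ‖g‖ ^ 2 ≤ (M + m) * (c * (‖Z y‖ * ‖y‖)) := by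
    refine h1.trans ?_
    have : 0 ≤ M + m := by positivity
    gcongr
    exact h2.trans (by gcongr)
  rw [div_mul_eq_mul_div, le_div_iff₀ (by positivity)]
  -- Completing the square in `‖Z y‖` eliminates it and produces the factor `1/4`.
  nlinarith [sq_nonneg (2 * ‖Z y‖ - (M + m) * c * ‖y‖)]

theorem sq_le_smul_sq_of_le_smul {Z T : E →L[ℂ] E} {m M c : ℝ} (hm : 0 < m) (hmM : m ≤ M)
    (hmT : m • (1 : E →L[ℂ] E) ≤ T) (hTM : T ≤ M • (1 : E →L[ℂ] E)) (hZ : 0 ≤ Z) (hc : 0 < c)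
    (hZT : Z ≤ c • T) :
    Z ^ 2 ≤ ((M + m) ^ 2 * c ^ 2 / (4 * (M * m))) • T ^ 2 := by
  have hT := nonneg_of_smul_one_le hm.le hmT
  have hM : 0 < M := hm.trans_le hmM
  obtain ⟨S, hTS, hST⟩ : ∃ S, T * S = 1 ∧ S * T = 1 :=
    isUnit_iff_exists.1 (isStrictlyPositive_of_smul_one_le hm hmT).isUnit
  have hZs := (IsSelfAdjoint.of_nonneg hZ)
  have hTs := (IsSelfAdjoint.of_nonneg hT)
  set κ := (M + m) ^ 2 * c ^ 2 / (4 * (M * m)) with hκ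
  have hκ0 : 0 ≤ κ := by positivity
  have hSZ : ∀ y, ‖S (Z y)‖ ^ 2 ≤ κ * ‖y‖ ^ 2 :=
    norm_apply_sq_le_of_mul_eq_one hm hmM hmT hTM hZ hc hZT hTS
  have hnorm : ‖S * Z‖ ≤ √κ := by
    refine ContinuousLinearMap.opNorm_le_bound _ (Real.sqrt_nonneg _) fun y => ?_
    rw [← Real.sqrt_sq (norm_nonneg y), ← Real.sqrt_mul hκ0]
    exact Real.le_sqrt_of_sq_le (hSZ y)
  have hSs : star S = S := by
    have : star S * T = 1 := by
      rw [← hTs.star_eq, ← star_mul, hTS, star_one]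
    calc star S = star S * (T * S) := by rw [hTS, mul_one]
      _ = S := by rw [← mul_assoc, this, one_mul]
  -- Passing to the adjoint puts `S = T⁻¹` on the right, so that `Z x = (Z S)(T x)` can be
  -- estimated.
  have hnorm' : ‖Z * S‖ ≤ √κ := by
    rwa [← norm_star, star_mul, hSs, hZs.star_eq]
  have hT2 : IsSelfAdjoint (κ • T ^ 2) := by
    rw [IsSelfAdjoint, star_smul, star_trivial, star_pow, hTs.star_eq]
  refine le_of_re_inner_le (hZs.pow 2) hT2 fun x => ?_
  have e1 : ⟪(Z ^ 2) x, x⟫_ℂ = ⟪Z x, Z x⟫_ℂ := by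
    rw [pow_two]; exact inner_symm_of_nonneg hZ _ _
  have e2 : RCLike.re ⟪(κ • T ^ 2) x, x⟫_ℂ = κ * RCLike.re ⟪T x, T x⟫_ℂ := by
    rw [smul_apply, re_inner_real_smul, pow_two, ← inner_symm_of_nonneg hT]
    rfl
  rw [e1, e2, re_inner_self_eq, re_inner_self_eq]
  have h5 : ‖Z x‖ ≤ √κ * ‖T x‖ := by
    have : Z x = (Z * S) (T x) := by
      exact (congrArg (fun R : E →L[ℂ] E => Z (R x)) hST).symm
    rw [this]
    exact ((Z * S).le_opNorm _).trans (by gcongr)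
  calc ‖Z x‖ ^ 2 ≤ (√κ * ‖T x‖) ^ 2 := by gcongr
    _ = κ * ‖T x‖ ^ 2 := by rw [mul_pow, Real.sq_sqrt hκ0]

end Powers

/-! ### Positive 2×2 operator matrices and Schur complements. -/

section OperatorMatrix

variable {E : Type*} [NormedAddCommGroup E] [InnerProductSpace ℂ E]

theorem inner_opMatrix (A B C D : E →L[ℂ] E) (x y x' y' : E) :
    ⟪opMatrix A B C D (WithLp.toLp 2 (x, y)), WithLp.toLp 2 (x', y')⟫_ℂ =
      ⟪A x, x'⟫_ℂ + ⟪B y, x'⟫_ℂ + (⟪C x, y'⟫_ℂ + ⟪D y, y'⟫_ℂ) := by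
  rw [← inner_add_left, ← inner_add_left]
  rfl

theorem inner_opMatrix_right (A B C D : E →L[ℂ] E) (x y x' y' : E) :
    ⟪WithLp.toLp 2 (x, y), opMatrix A B C D (WithLp.toLp 2 (x', y'))⟫_ℂ =
      ⟪x, A x'⟫_ℂ + ⟪x, B y'⟫_ℂ + (⟪y, C x'⟫_ℂ + ⟪y, D y'⟫_ℂ) := by
  rw [← inner_add_right, ← inner_add_right]
  rfl

theorem opMatrix_symm {A B C D : E →L[ℂ] E} (h : 0 ≤ opMatrix A B C D) (x y x' y' : E) :
    ⟪A x, x'⟫_ℂ + ⟪B y, x'⟫_ℂ + (⟪C x, y'⟫_ℂ + ⟪D y, y'⟫_ℂ) =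
      ⟪x, A x'⟫_ℂ + ⟪x, B y'⟫_ℂ + (⟪y, C x'⟫_ℂ + ⟪y, D y'⟫_ℂ) := by
  rw [← inner_opMatrix, ← inner_opMatrix_right]
  exact inner_symm_of_nonneg h _ _

theorem opMatrix_re_inner_nonneg {A B C D : E →L[ℂ] E} (h : 0 ≤ opMatrix A B C D) (x y : E) :
    0 ≤ RCLike.re ⟪A x, x⟫_ℂ + RCLike.re ⟪B y, x⟫_ℂ +
      (RCLike.re ⟪C x, y⟫_ℂ + RCLike.re ⟪D y, y⟫_ℂ) := by
  have := re_inner_nonneg h (WithLp.toLp 2 (x, y))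
  rw [inner_opMatrix] at this
  simpa only [map_add] using this

theorem nonneg_fst_of_opMatrix_nonneg {A B C D : E →L[ℂ] E} (h : 0 ≤ opMatrix A B C D) :
    0 ≤ A := by
  rw [ContinuousLinearMap.nonneg_iff_isPositive, ContinuousLinearMap.isPositive_def]
  refine ⟨fun x y => ?_, fun x => ?_⟩
  · simpa using opMatrix_symm h x 0 y 0
  · simpa [ContinuousLinearMap.reApplyInnerSelf] using opMatrix_re_inner_nonneg h x 0

variable [CompleteSpace E]

theorem eq_star_of_opMatrix_nonneg {A B C D : E →L[ℂ] E} (h : 0 ≤ opMatrix A B C D) :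
    C = star B := by
  refine (ContinuousLinearMap.eq_adjoint_iff C B).2 fun x y => ?_
  simpa using opMatrix_symm h x 0 0 y

theorem opMatrix_nonneg {A B D : E →L[ℂ] E} (hA : IsSelfAdjoint A) (hD : IsSelfAdjoint D)
    (h : ∀ x y, 0 ≤ RCLike.re ⟪A x, x⟫_ℂ + 2 * RCLike.re ⟪B y, x⟫_ℂ + RCLike.re ⟪D y, y⟫_ℂ) :
    0 ≤ opMatrix A B (star B) D := by
  have adj : ∀ x y : E, ⟪(star B) x, y⟫_ℂ = ⟪x, B y⟫_ℂ := fun x y =>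
    ContinuousLinearMap.adjoint_inner_left B y x
  have adj' : ∀ x y : E, ⟪x, (star B) y⟫_ℂ = ⟪B x, y⟫_ℂ := fun x y =>
    ContinuousLinearMap.adjoint_inner_right B x y
  rw [ContinuousLinearMap.nonneg_iff_isPositive, ContinuousLinearMap.isPositive_def]
  refine ⟨?_, ?_⟩
  · rintro ⟨x, y⟩ ⟨x', y'⟩
    refine (inner_opMatrix _ _ _ _ _ _ _ _).trans
      (Eq.trans ?_ (inner_opMatrix_right _ _ _ _ _ _ _ _).symm)
    have hA' : ⟪A x, x'⟫_ℂ = ⟪x, A x'⟫_ℂ := hA.isSymmetric x x'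
    have hD' : ⟪D y, y'⟫_ℂ = ⟪y, D y'⟫_ℂ := hD.isSymmetric y y'
    rw [adj, adj', hA', hD']
    ring
  · rintro ⟨x, y⟩
    have e := inner_opMatrix A B (star B) D x y x y
    rw [adj] at e
    have := h x y
    have e2 := inner_re_symm (𝕜 := ℂ) x (B y)
    rw [ContinuousLinearMap.reApplyInnerSelf, e]
    simp only [map_add]
    linarith

/-- The Schur complement of a positive operator matrix is positive. -/
theorem mul_inverse_mul_le_of_opMatrix_nonneg {A B C D : E →L[ℂ] E}
    (h : 0 ≤ opMatrix A B C D) (hD : IsStrictlyPositive D) :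
    0 ≤ B * Ring.inverse D * C ∧ B * Ring.inverse D * C ≤ A := by
  have hC := eq_star_of_opMatrix_nonneg h
  have hR : 0 ≤ Ring.inverse D := hD.ringInverse.nonneg
  have h0 : 0 ≤ B * Ring.inverse D * C := by
    rw [hC]; exact star_right_conjugate_nonneg hR B
  refine ⟨h0, le_of_re_inner_le (.of_nonneg h0)
    (.of_nonneg (nonneg_fst_of_opMatrix_nonneg h)) fun x => ?_⟩
  -- The second component `-D⁻¹Cx` minimises the form for fixed `x`.
  have h1 := opMatrix_re_inner_nonneg h x (-(Ring.inverse D (C x)))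
  have h2 : D (Ring.inverse D (C x)) = C x :=
    congrArg (fun R : E →L[ℂ] E => R (C x)) (Ring.mul_inverse_cancel D hD.isUnit)
  have h3 : (B * Ring.inverse D * C) x = B (Ring.inverse D (C x)) := rfl
  rw [h3]
  simp only [map_neg, inner_neg_left, inner_neg_right, h2] at h1
  linarith

end OperatorMatrix

/-! ### The Wielandt inequality under a 2-positive map. -/

section TwoPositive

variable {H K : Type*} [NormedAddCommGroup H] [InnerProductSpace ℂ H] [CompleteSpace H]
  [NormedAddCommGroup K] [InnerProductSpace ℂ K]

theorem IsTwoPositive.nonneg {Φ : (H →L[ℂ] H) →ₗ[ℂ] (K →L[ℂ] K)} (hΦ : IsTwoPositive Φ)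
    {A : H →L[ℂ] H} (hA : 0 ≤ A) : 0 ≤ Φ A := by
  refine nonneg_fst_of_opMatrix_nonneg (hΦ A 0 0 (opMatrix_nonneg (.of_nonneg hA) (.zero _) ?_))
  intro x y
  simpa using re_inner_nonneg hA x

variable [CompleteSpace K]

theorem IsTwoPositive.mono {Φ : (H →L[ℂ] H) →ₗ[ℂ] (K →L[ℂ] K)} (hΦ : IsTwoPositive Φ)
    {A B : H →L[ℂ] H} (h : A ≤ B) : Φ A ≤ Φ B := by
  have := hΦ.nonneg (sub_nonneg.2 h)
  rwa [map_sub, sub_nonneg] at this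

theorem star_mul_self_of_isometry {X : H →L[ℂ] H} (hX : Isometry X) : star X * X = 1 :=
  (ContinuousLinearMap.norm_map_iff_adjoint_comp_self X).1
    ((AddMonoidHomClass.isometry_iff_norm X).1 hX)

theorem smul_one_le_star_mul_mul {A X : H →L[ℂ] H} {m : ℝ} (hX : Isometry X)
    (h : m • (1 : H →L[ℂ] H) ≤ A) : m • (1 : H →L[ℂ] H) ≤ star X * A * X := by
  have := star_left_conjugate_le_conjugate h X
  rwa [mul_smul_comm, mul_one, smul_mul_assoc, star_mul_self_of_isometry hX] at this

theorem star_mul_mul_le_smul_one {A X : H →L[ℂ] H} {M : ℝ} (hX : Isometry X)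
    (h : A ≤ M • (1 : H →L[ℂ] H)) : star X * A * X ≤ M • (1 : H →L[ℂ] H) := by
  have := star_left_conjugate_le_conjugate h X
  rwa [mul_smul_comm, mul_one, smul_mul_assoc, star_mul_self_of_isometry hX] at this

/-- The Wielandt inequality, as positivity of a quadratic form on orthogonal vectors. -/
theorem wielandt_nonneg {A : H →L[ℂ] H} {m M : ℝ} (hm : 0 < m) (hmM : m ≤ M)
    (hmA : m • (1 : H →L[ℂ] H) ≤ A) (hAM : A ≤ M • (1 : H →L[ℂ] H)) {ξ η : H}
    (h : ⟪ξ, η⟫_ℂ = 0) :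
    0 ≤ ((M - m) / (M + m)) ^ 2 * RCLike.re ⟪A ξ, ξ⟫_ℂ + 2 * RCLike.re ⟪A η, ξ⟫_ℂ +
      RCLike.re ⟪A η, η⟫_ℂ := by
  have hA := nonneg_of_smul_one_le hm.le hmA
  rcases hmM.eq_or_lt with rfl | hlt
  · have hAm : A = m • (1 : H →L[ℂ] H) := le_antisymm hAM hmA
    have h1 : RCLike.re ⟪A η, ξ⟫_ℂ = 0 := by
      rw [hAm, smul_apply, re_inner_real_smul, inner_re_symm, one_apply_eq_self, h]
      simp
    rw [h1]
    simpa using re_inner_nonneg hA η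
  · set k := (M - m) / (M + m) with hk
    have hMm : 0 < M + m := by linarith
    have hkM : k * (M + m) = M - m := div_mul_cancel₀ _ hMm.ne'
    set u : H := k • ξ with hu
    have huη : RCLike.re ⟪u, η⟫_ℂ = 0 := by
      rw [hu, re_inner_real_smul, h]; simp
    have h1 := re_inner_le_of_le hmA (u + η)
    have h2 := re_inner_le_of_le hAM (u - η)
    rw [smul_apply, re_inner_real_smul, one_apply_eq_self, re_inner_add_self hA,
      re_inner_self_eq, norm_add_sq (𝕜 := ℂ), huη] at h1
    rw [smul_apply, re_inner_real_smul, one_apply_eq_self, re_inner_sub_self hA,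
      re_inner_self_eq, norm_sub_sq (𝕜 := ℂ), huη] at h2
    have e1 : RCLike.re ⟪A u, η⟫_ℂ = k * RCLike.re ⟪A η, ξ⟫_ℂ := by
      rw [re_inner_comm_of_nonneg hA η ξ, hu, ContinuousLinearMap.map_smul_of_tower, re_inner_real_smul]
    have e2 : RCLike.re ⟪A u, u⟫_ℂ = k ^ 2 * RCLike.re ⟪A ξ, ξ⟫_ℂ := by
      rw [hu, ContinuousLinearMap.map_smul_of_tower, re_inner_real_smul, inner_re_symm, re_inner_real_smul,
        inner_re_symm]
      ring
    rw [e1, e2] at h1 h2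
    generalize RCLike.re ⟪A ξ, ξ⟫_ℂ = a at *
    generalize RCLike.re ⟪A η, ξ⟫_ℂ = b at *
    generalize RCLike.re ⟪A η, η⟫_ℂ = d at *
    -- Weighting the lower bound at `u + η` by `M` and the upper bound at `u - η` by `m` cancels the
    -- norm terms, as `u ⟂ η`. The scaling `u = kξ` leaves a common factor `M - m`, hence the
    -- separate case `m = M`.
    have h3 := mul_le_mul_of_nonneg_left h1 (hm.le.trans hmM)
    have h4 := mul_le_mul_of_nonneg_left h2 hm.le
    have h5 : 0 ≤ (M - m) * (k ^ 2 * a + 2 * b + d) := by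
      have : (M - m) * (2 * b) = 2 * ((k * (M + m)) * b) := by rw [hkM]; ring
      rw [mul_add, mul_add, this]
      nlinarith
    exact nonneg_of_mul_nonneg_right h5 (by linarith)

theorem opMatrix_wielandt_nonneg {A X Y : H →L[ℂ] H} {m M : ℝ} (hm : 0 < m) (hmM : m ≤ M)
    (hmA : m • (1 : H →L[ℂ] H) ≤ A) (hAM : A ≤ M • (1 : H →L[ℂ] H))
    (hXY : X.range ⟂ Y.range) :
    0 ≤ opMatrix (((M - m) / (M + m)) ^ 2 • (star X * A * X)) (star X * A * Y)
      (star (star X * A * Y)) (star Y * A * Y) := by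
  have hA := nonneg_of_smul_one_le hm.le hmA
  have hc : 0 ≤ ((M - m) / (M + m)) ^ 2 := sq_nonneg _
  have conj : ∀ (U V : H →L[ℂ] H) (x y : H), ⟪(star U * A * V) x, y⟫_ℂ = ⟪A (V x), U y⟫_ℂ :=
    fun U V x y => ContinuousLinearMap.adjoint_inner_left U y (A (V x))
  refine opMatrix_nonneg
    (.of_nonneg (smul_nonneg hc (star_left_conjugate_nonneg hA X)))
    (.of_nonneg (star_left_conjugate_nonneg hA Y)) fun x y => ?_
  rw [smul_apply, re_inner_real_smul, conj, conj, conj]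
  exact wielandt_nonneg hm hmM hmA hAM
    (hXY.inner_eq (LinearMap.mem_range_self _ x) (LinearMap.mem_range_self _ y))

/-- The operator Wielandt inequality of Bhatia and Davis. -/
theorem IsTwoPositive.wielandtOp_le {Φ : (H →L[ℂ] H) →ₗ[ℂ] (K →L[ℂ] K)}
    (hΦ : IsTwoPositive Φ) {A X Y : H →L[ℂ] H} {m M : ℝ} (hm : 0 < m) (hmM : m ≤ M)
    (hmA : m • (1 : H →L[ℂ] H) ≤ A) (hAM : A ≤ M • (1 : H →L[ℂ] H))
    (hXY : X.range ⟂ Y.range) (hS : IsStrictlyPositive (Φ (star Y * A * Y))) :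
    0 ≤ wielandtOp Φ A X Y ∧
      wielandtOp Φ A X Y ≤ ((M - m) / (M + m)) ^ 2 • Φ (star X * A * X) := by
  have hA := nonneg_of_smul_one_le hm.le hmA
  have h := mul_inverse_mul_le_of_opMatrix_nonneg
    (hΦ _ _ _ (opMatrix_wielandt_nonneg hm hmM hmA hAM hXY)) hS
  have hst : star (star X * A * Y) = star Y * A * X := by
    rw [star_mul, star_mul, star_star, (IsSelfAdjoint.of_nonneg hA).star_eq, mul_assoc]
  rwa [hst, LinearMap.map_smul_of_tower] at h

end TwoPositive

/-! ### Norm bounds for `Z^(p/2) T^(-p/2)`. -/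

section Bounds

variable {E : Type*} [NormedAddCommGroup E] [InnerProductSpace ℂ E] [CompleteSpace E]

theorem norm_rpow_mul_rpow_le_of_le_smul {P V W : E →L[ℂ] E} {c d e r : ℝ} (hP : 0 ≤ P)
    (hV : 0 ≤ V) (hc : 0 < c) (hd : 0 < d) (he : 0 < e) (hr : 1 ≤ r) (hPW : P ≤ c • W)
    (hVW : V + e • W ≤ d • (1 : E →L[ℂ] E)) :
    ‖P ^ r * V ^ r‖ ≤ (d ^ 2 * c / e) ^ r / 4 := by
  -- Chosen so that `αc = α⁻¹e`: then `αP ≤ α⁻¹e W`, and the bound on `V + e W` applies.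
  set α := √(e / c) with hα_def
  have hα : 0 < α := Real.sqrt_pos.2 (by positivity)
  have hα2 : α ^ 2 = e / c := Real.sq_sqrt (by positivity)
  have hsum : α • P + α⁻¹ • V ≤ (α⁻¹ * d) • (1 : E →L[ℂ] E) := by
    have h1 := smul_le_smul_of_nonneg_left hPW hα.le
    have h2 := smul_le_smul_of_nonneg_left hVW (inv_nonneg.2 hα.le)
    have h3 : α * c = α⁻¹ * e := by
      field_simp
      rw [hα2]
      field_simp
    rw [smul_smul, h3] at h1
    rw [smul_add, smul_smul, smul_smul, add_comm] at h2
    exact (add_le_add_left h1 _).trans h2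
  refine (norm_rpow_mul_rpow_le hP hV hα (by positivity) hr hsum).trans_eq ?_
  rw [← Real.rpow_natCast, ← Real.rpow_mul (by positivity), mul_comm r,
    Real.rpow_mul (by positivity), Real.rpow_natCast]
  congr 2
  rw [mul_pow, inv_pow, hα2]
  field_simp

theorem norm_rpow_mul_rpow_neg_le {Z T : E →L[ℂ] E} {m M p : ℝ} (hm : 0 < m) (hmM : m < M)
    (hmT : m • (1 : E →L[ℂ] E) ≤ T) (hTM : T ≤ M • (1 : E →L[ℂ] E)) (hZ : 0 ≤ Z)
    (hZT : Z ≤ ((M - m) / (M + m)) ^ 2 • T) (hp : 2 ≤ p) :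
    ‖Z ^ (p / 2) * T ^ (-(p / 2))‖ ≤ ((M - m) ^ 4 / (M * m) ^ 2) ^ (p / 4) / 4 := by
  have hT := nonneg_of_smul_one_le hm.le hmT
  have hTp := isStrictlyPositive_of_smul_one_le hm hmT
  have hM : 0 < M := hm.trans hmM
  have hMm : 0 < M - m := sub_pos.2 hmM
  have h1 := rpow_neg_add_smul_rpow_le hm one_pos hmT hTM
  rw [CFC.rpow_one T hT, Real.rpow_one, Real.rpow_one, Real.rpow_one] at h1
  have h2 := norm_rpow_mul_rpow_le_of_le_smul hZ CFC.rpow_nonneg (by positivity)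
    (by positivity) (by positivity) (by linarith : 1 ≤ p / 2) hZT h1
  rw [CFC.rpow_rpow T (-1) (p / 2) (by norm_num) hTp, neg_one_mul] at h2
  refine h2.trans_eq ?_
  congr 1
  rw [show p / 2 = 2 * (p / 4) by ring, Real.rpow_mul (by positivity), Real.rpow_two]
  congr 1
  field_simp

theorem norm_rpow_mul_rpow_neg_le_of_four_le {Z T : E →L[ℂ] E} {m M p : ℝ} (hm : 0 < m)
    (hmM : m < M) (hmT : m • (1 : E →L[ℂ] E) ≤ T) (hTM : T ≤ M • (1 : E →L[ℂ] E)) (hZ : 0 ≤ Z)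
    (hZT : Z ≤ ((M - m) / (M + m)) ^ 2 • T) (hp : 4 ≤ p) :
    ‖Z ^ (p / 2) * T ^ (-(p / 2))‖ ≤
      ((M - m) ^ 4 * (M ^ 2 + m ^ 2) ^ 2 / (4 * (M * m) ^ 3 * (M + m) ^ 2)) ^ (p / 4) / 4 := by
  have hT := nonneg_of_smul_one_le hm.le hmT
  have hTp := isStrictlyPositive_of_smul_one_le hm hmT
  have hM : 0 < M := hm.trans hmM
  have hMm : 0 < M - m := sub_pos.2 hmM
  have h1 := rpow_neg_add_smul_rpow_le hm two_pos hmT hTM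
  rw [Real.rpow_two, Real.rpow_two, Real.rpow_two] at h1
  have hc : 0 < ((M - m) / (M + m)) ^ 2 := by positivity
  have hsq := sq_le_smul_sq_of_le_smul hm hmM.le hmT hTM hZ hc hZT
  have hZ2 : Z ^ 2 = Z ^ (2 : ℝ) := by exact_mod_cast (CFC.rpow_natCast Z 2 hZ).symm
  have hT2 : T ^ 2 = T ^ (2 : ℝ) := by exact_mod_cast (CFC.rpow_natCast T 2 hT).symm
  rw [hZ2, hT2] at hsq
  have hZ2n : 0 ≤ Z ^ (2 : ℝ) := CFC.rpow_nonneg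
  have hT2n : 0 ≤ T ^ (-2 : ℝ) := CFC.rpow_nonneg
  have h2 := norm_rpow_mul_rpow_le_of_le_smul hZ2n hT2n (by positivity)
    (by positivity) (by positivity) (by linarith : 1 ≤ p / 4) hsq h1
  rw [CFC.rpow_rpow T (-2) (p / 4) (by norm_num) hTp,
    CFC.rpow_rpow_of_exponent_nonneg Z 2 (p / 4) (by norm_num) (by linarith) hZ,
    show 2 * (p / 4) = p / 2 by ring, show -2 * (p / 4) = -(p / 2) by ring] at h2
  refine h2.trans_eq ?_
  congr 2
  field_simp

theorem rpow_eq_pow_rpow {x : ℝ} (hx : 0 ≤ x) (n : ℕ) (q : ℝ) :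
    (x ^ n) ^ q = x ^ (n * q) := by
  rw [← Real.rpow_natCast, Real.rpow_mul hx]

theorem two_rpow_two_add (p : ℝ) : (2 : ℝ) ^ (2 + p / 2) = 4 * 4 ^ (p / 4) := by
  have h : (4 : ℝ) = 2 ^ 2 := by norm_num
  rw [Real.rpow_add two_pos, h, rpow_eq_pow_rpow zero_le_two, Real.rpow_two]
  congr 2
  push_cast
  ring

end Bounds

end WielandtNorm

/-! ### Assembly and comparison of constants. -/

theorem corollary3p2 {H K : Type*}
    [NormedAddCommGroup H] [InnerProductSpace ℂ H] [CompleteSpace H]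
    [NormedAddCommGroup K] [InnerProductSpace ℂ K] [CompleteSpace K]
    (m M : ℝ) (hm : 0 < m) (hmM : m ≤ M)
    (A : H →L[ℂ] H)
    (hmA : m • (1 : H →L[ℂ] H) ≤ A) (hAM : A ≤ M • (1 : H →L[ℂ] H))
    (X Y : H →L[ℂ] H) (hX : Isometry X) (hY : Isometry Y)
    (hXY : X.range ⟂ Y.range)
    (Φ : (H →L[ℂ] H) →ₗ[ℂ] (K →L[ℂ] K))
    (hΦ : WielandtNorm.IsTwoPositive Φ) (hΦ1 : Φ 1 = 1) :
    (0 ≤ Φ (star Y * A * Y) ∧ IsUnit (Φ (star Y * A * Y))) ∧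
    (0 ≤ Φ (star X * A * X) ∧ IsUnit (Φ (star X * A * X))) ∧
    0 ≤ WielandtNorm.wielandtOp Φ A X Y ∧
    (∀ p : ℝ, 2 ≤ p →
      ‖(WielandtNorm.wielandtOp Φ A X Y) ^ (p / 2) * (Φ (star X * A * X)) ^ (-(p / 2))‖ ≤
        (M - m) ^ p * (M + m) ^ (p / 2) /
          ((2 : ℝ) ^ (2 + p / 2) * M ^ (3 * p / 4) * m ^ (3 * p / 4))) ∧
    (∀ p : ℝ, 4 ≤ p →
      ‖(WielandtNorm.wielandtOp Φ A X Y) ^ (p / 2) * (Φ (star X * A * X)) ^ (-(p / 2))‖ ≤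
        (M - m) ^ p * (M ^ 2 + m ^ 2) ^ (p / 2) /
          ((2 : ℝ) ^ (2 + p / 2) * M ^ (3 * p / 4) * m ^ (3 * p / 4) * (M + m) ^ (p / 2))) := by
  have hM : 0 < M := hm.trans_le hmM
  have hMm : 0 ≤ M - m := sub_nonneg.2 hmM
  have lower : ∀ V : H →L[ℂ] H, Isometry V → m • (1 : K →L[ℂ] K) ≤ Φ (star V * A * V) := by
    intro V hV
    have := hΦ.mono (WielandtNorm.smul_one_le_star_mul_mul hV hmA)
    rwa [LinearMap.map_smul_of_tower, hΦ1] at this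
  have upper : Φ (star X * A * X) ≤ M • (1 : K →L[ℂ] K) := by
    have := hΦ.mono (WielandtNorm.star_mul_mul_le_smul_one hX hAM)
    rwa [LinearMap.map_smul_of_tower, hΦ1] at this
  have hSp := WielandtNorm.isStrictlyPositive_of_smul_one_le hm (lower Y hY)
  have hTp := WielandtNorm.isStrictlyPositive_of_smul_one_le hm (lower X hX)
  obtain ⟨hZ, hZT⟩ := hΦ.wielandtOp_le hm hmM hmA hAM hXY hSp
  refine ⟨⟨hSp.nonneg, hSp.isUnit⟩, ⟨hTp.nonneg, hTp.isUnit⟩, hZ, ?_⟩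
  generalize WielandtNorm.wielandtOp Φ A X Y = Z at hZ hZT ⊢
  have hmT := lower X hX
  generalize Φ (star X * A * X) = T at hZT hmT upper ⊢
  rcases hmM.eq_or_lt with rfl | hlt
  -- For `m = M` the constant `k²` vanishes and forces `Z = 0`; the general bounds need it positive.
  · have hZ0 : Z = 0 := le_antisymm (by simpa using hZT) hZ
    have zero : ∀ p : ℝ, 2 ≤ p → ‖Z ^ (p / 2) * T ^ (-(p / 2))‖ = 0 := by
      intro p hp
      have : Z ^ (p / 2) = 0 := by
        rw [hZ0]; exact CFC.zero_rpow (by positivity)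
      rw [this, zero_mul, norm_zero]
    refine ⟨fun p hp => ?_, fun p hp => ?_⟩
    · rw [zero p hp]; positivity
    · rw [zero p (by linarith)]; positivity
  · refine ⟨fun p hp => ?_, fun p hp => ?_⟩
    · refine (WielandtNorm.norm_rpow_mul_rpow_neg_le hm hlt hmT upper hZ hZT hp).trans ?_
      calc ((M - m) ^ 4 / (M * m) ^ 2) ^ (p / 4) / 4
          ≤ ((M - m) ^ 4 * (M + m) ^ 2 / (4 * (M ^ 3 * m ^ 3))) ^ (p / 4) / 4 := by
            gcongr ?_ ^ _ / 4
            rw [div_le_div_iff₀ (by positivity) (by positivity)]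
            -- The bound already obtained is smaller than the stated one by the factor
            -- `(4Mm/(M+m)²)^(p/4)`.
            have h1 : 4 * (M * m) ≤ (M + m) ^ 2 := by nlinarith [sq_nonneg (M - m)]
            calc (M - m) ^ 4 * (4 * (M ^ 3 * m ^ 3))
                = (M - m) ^ 4 * (4 * (M * m)) * (M * m) ^ 2 := by ring
              _ ≤ (M - m) ^ 4 * (M + m) ^ 2 * (M * m) ^ 2 := by gcongr
        _ = _ := by
          rw [WielandtNorm.two_rpow_two_add, Real.div_rpow (by positivity) (by positivity),
            Real.mul_rpow (by positivity) (by positivity),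
            Real.mul_rpow (by positivity) (by positivity),
            Real.mul_rpow (by positivity) (by positivity),
            WielandtNorm.rpow_eq_pow_rpow hMm, WielandtNorm.rpow_eq_pow_rpow (by positivity),
            WielandtNorm.rpow_eq_pow_rpow hM.le, WielandtNorm.rpow_eq_pow_rpow hm.le, div_div]
          push_cast
          ring_nf
    · refine (WielandtNorm.norm_rpow_mul_rpow_neg_le_of_four_le hm hlt hmT upper hZ hZT
        hp).trans_eq ?_
      rw [WielandtNorm.two_rpow_two_add, Real.div_rpow (by positivity) (by positivity), mul_pow,
        Real.mul_rpow (by positivity) (by positivity),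
        Real.mul_rpow (by positivity) (by positivity),
        Real.mul_rpow (by positivity) (by positivity),
        Real.mul_rpow (by positivity) (by positivity),
        WielandtNorm.rpow_eq_pow_rpow hMm, WielandtNorm.rpow_eq_pow_rpow (by positivity),
        WielandtNorm.rpow_eq_pow_rpow hM.le, WielandtNorm.rpow_eq_pow_rpow hm.le,
        WielandtNorm.rpow_eq_pow_rpow (by positivity), div_div]
      push_cast
      ring_nf
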